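/- Let $q,h>0$, $\theta_+=(1+q/h)^{1/4}-1$ and $0<\theta_{ig}<\theta_{hl}<\theta_+$, and let $F(\theta)=q-h((1+\theta)^4-1)$. Put $$Q_+=\{(R,c): R>0,\ c\ge qR/\theta_{hl}\},\qquad G(R,c)=(e^{cR}-1-cR)\,q-c^2(\theta_{ig}e^{cR}-\theta_{hl}).$$ For $c>0$ let $S_c$ be the stable separatrix of the equilibrium $(\theta_+,0)$ of the system $u'=v,\ v'=cv-F(u)$ in the strip $[\theta_{hl},\theta_+]\times[0,\infty)$, i.e. the set of points of the strip whose forward trajectory stays in the strip and tends to $(\theta_+,0)$. Then: 1. There are $R_0>0$ and a continuous, strictly decreasing function $\varphi:(0,R_0]\to\mathbb R$ such that the level set $\{(R,c)\in Q_+: G(R,c)=0\}$ is the graph of $\varphi$; moreover $\varphi(R_0)=qR_0/\theta_{hl}$ and $\varphi(R)\to+\infty$ as $R\to0^+$. 2. There is a continuous, strictly increasing function $\psi:[0,\infty)\to\mathbb R$ whose graph is the set of all $(R,c)$ with $R\ge0$, $c>0$ and $(\theta_{hl},\,c\theta_{hl}-qR)\in S_c$; moreover $\psi(R)>qR/\theta_{hl}$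 for all $R\ge0$. 3. The graphs of $\varphi$ and $\psi$ have exactly one common point $(R^*,c^*)$, that is, there is exactly one pair with $c^*=\varphi(R^*)=\psi(R^*)$, and this point lies in the interior of $Q_+$. -/

import Mathlib

open Set Filter Topology

noncomputable section

/-- The temperature far behind the front, `θ₊ = (1 + q/h)^(1/4) - 1`. -/
def thetaPlus (q h : ℝ) : ℝ := (1 + q / h) ^ (1 / 4 : ℝ) - 1

/-- The nonlinearity `F(θ) = q - h((1+θ)⁴ - 1)`. -/
def nonlinF (q h θ : ℝ) : ℝ := q - h * ((1 + θ) ^ 4 - 1)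

/-- The domain `Q₊` of the quadrant, with points written `p = (R, c)`. -/
def Qplus (q θhl : ℝ) : Set (ℝ × ℝ) := {p | 0 < p.1 ∧ q * p.1 / θhl ≤ p.2}

/-- The function `G(R,c)` of the transcendental relation. -/
def transG (q θig θhl R c : ℝ) : ℝ :=
  (Real.exp (c * R) - 1 - c * R) * q - c ^ 2 * (θig * Real.exp (c * R) - θhl)

/-- The level set `{(R,c) ∈ Q₊ | G(R,c) = 0}`. -/
def phiCurve (q θig θhl : ℝ) : Set (ℝ × ℝ) :=
  {p | p ∈ Qplus q θhl ∧ transG q θig θhl p.1 p.2 = 0}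

/-- The strip `[θhl, θ₊] × [0, ∞)` of the phase plane. -/
def phaseStrip (θhl θp : ℝ) : Set (ℝ × ℝ) := {p | p.1 ∈ Icc θhl θp ∧ 0 ≤ p.2}

/-- `(u, v)` is a trajectory on `[0, ∞)` of the vector field `X_c : u' = v, v' = c v - F(u)`. -/
def IsForwardTrajectory (F : ℝ → ℝ) (c : ℝ) (u v : ℝ → ℝ) : Prop :=
  ∀ t, 0 ≤ t →
    HasDerivWithinAt u (v t) (Ici 0) t ∧ HasDerivWithinAt v (c * v t - F (u t)) (Ici 0) t

/-- The stable separatrix `S_c` of the equilibrium `(θ₊, 0)` in the strip `[θhl, θ₊] × [0, ∞)`: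
the points of the strip whose forward trajectory stays in the strip and tends to `(θ₊, 0)`. -/
def stableSeparatrix (F : ℝ → ℝ) (c θhl θp : ℝ) : Set (ℝ × ℝ) :=
  {p | ∃ u v : ℝ → ℝ, IsForwardTrajectory F c u v ∧ (u 0, v 0) = p ∧
    (∀ t, 0 ≤ t → (u t, v t) ∈ phaseStrip θhl θp) ∧
    Tendsto u atTop (𝓝 θp) ∧ Tendsto v atTop (𝓝 0)}

/-- The pairs `(R,c)`, `R ≥ 0`, `c > 0`, for which `c θhl - q R = v_c(θhl)`, where `v = v_c(u)` is
the separatrix `S_c` written as a graph; that is, `(θhl, c θhl - q R)` lies on `S_c`. -/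
def psiCurve (q h θhl : ℝ) : Set (ℝ × ℝ) :=
  {p | 0 ≤ p.1 ∧ 0 < p.2 ∧
    (θhl, p.2 * θhl - q * p.1) ∈ stableSeparatrix (nonlinF q h) p.2 θhl (thetaPlus q h)}

end

/-!
In terms of the distance `s = θ₊ - u` to the equilibrium, a separatrix written as `v = s p(s)`
satisfies the singular equation `s p' = m / p - c - p`, where `F(θ₊ - s) = s m(s)`; its solution
regular at `s = 0` is the fixed point of a weighted average over `[0, s]`. Two trajectories on
`S_c` with the same `u(0)` coincide because `e^{-ct} (u₁ - u₂) (v₁ - v₂)` is nondecreasing, `F`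
being decreasing, and vanishes at both `t = 0` and `t = ∞`. Comparing the separatrices of two
speeds shows that their height `V(c) > 0` on the line `u = θhl` is nonincreasing and Lipschitz in
`c`. So `c ↦ c θhl - V(c)` is an increasing bijection of `ℝ`, and `ψ(R)` is its inverse at `q R`.

The level set `G = 0` is parametrised by `x = c R`, through
`c² = q (eˣ - 1 - x) / (θig eˣ - θhl)`. There `c` decreases and `R = x / c` increases in `x` up to
the positive zero `y` of the concave function `θhl (1 - e⁻ˣ) - θig x`, which is exactly where the
curve leaves `Q₊`.
-/

section SingularEquation

open scoped BoundedContinuousFunction NNReal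

section PowAverage

variable {E : Type*} [NormedAddCommGroup E] [NormedSpace ℝ E]

/-- The average of `f` over the segment from `0` to `s` with weight `x ^ n`: the solution `A`,
regular at `s = 0`, of the singular linear equation `s A' + (n + 1) A = f`. It is normalised so
that a constant `C` has average `C / (n + 1)`. -/
noncomputable def powAverage (n : ℕ) (f : ℝ → E) (s : ℝ) : E :=
  ∫ x in (0 : ℝ)..1, x ^ n • f (s * x)

lemma integral_pow_mul_const (n : ℕ) (C : ℝ) :
    ∫ x in (0 : ℝ)..1, x ^ n * C = C / (n + 1) := by
  simp [field]

lemma powAverage_const (n : ℕ) (C s : ℝ) : powAverage n (fun _ => C) s = C / (n + 1) :=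
  integral_pow_mul_const n C

lemma intervalIntegrable_pow_smul_comp_mul {f : ℝ → E} (hf : Continuous f) (n : ℕ) (s : ℝ) :
    IntervalIntegrable (fun x => x ^ n • f (s * x)) MeasureTheory.volume 0 1 :=
  (by fun_prop : Continuous fun x : ℝ => x ^ n • f (s * x)).intervalIntegrable 0 1

lemma continuous_powAverage {f : ℝ → E} (hf : Continuous f) (n : ℕ) :
    Continuous (powAverage n f) :=
  intervalIntegral.continuous_parametric_intervalIntegral_of_continuous'
    (f := fun s x => x ^ n • f (s * x)) (by fun_prop) 0 1

lemma norm_powAverage_le {f : ℝ → E} {B : ℝ} (hB : ∀ s, ‖f s‖ ≤ B) (n : ℕ) (s : ℝ) :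
    ‖powAverage n f s‖ ≤ B / (n + 1) := by
  rw [← integral_pow_mul_const]
  refine intervalIntegral.norm_integral_le_of_norm_le zero_le_one (.of_forall fun x hx => ?_)
    ((by fun_prop : Continuous fun x : ℝ => x ^ n * B).intervalIntegrable 0 1)
  rw [norm_smul, norm_pow, Real.norm_of_nonneg hx.1.le]
  exact mul_le_mul_of_nonneg_left (hB _) (pow_nonneg hx.1.le n)

lemma powAverage_sub {f g : ℝ → E} (hf : Continuous f) (hg : Continuous g) (n : ℕ) (s : ℝ) :
    powAverage n (fun x => f x - g x) s = powAverage n f s - powAverage n g s := by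
  simp only [powAverage, smul_sub]
  exact intervalIntegral.integral_sub (intervalIntegrable_pow_smul_comp_mul hf n s)
    (intervalIntegrable_pow_smul_comp_mul hg n s)

lemma powAverage_mono {f g : ℝ → ℝ} (hf : Continuous f) (hg : Continuous g)
    (hfg : ∀ s, f s ≤ g s) (n : ℕ) (s : ℝ) : powAverage n f s ≤ powAverage n g s :=
  intervalIntegral.integral_mono_on zero_le_one (intervalIntegrable_pow_smul_comp_mul hf n s)
    (intervalIntegrable_pow_smul_comp_mul hg n s) fun _ hx =>
      mul_le_mul_of_nonneg_left (hfg _) (pow_nonneg hx.1 n)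

lemma pow_smul_powAverage (n : ℕ) (f : ℝ → E) (s : ℝ) :
    s ^ (n + 1) • powAverage n f s = ∫ σ in (0 : ℝ)..s, σ ^ n • f σ := by
  have h := intervalIntegral.smul_integral_comp_mul_left (a := 0) (b := 1)
    (fun σ => σ ^ n • f σ) s
  simp only [mul_pow, mul_smul, intervalIntegral.integral_smul, mul_zero, mul_one] at h
  rw [← h, pow_succ', mul_smul, powAverage]

lemma hasDerivAt_smul_powAverage [CompleteSpace E] {f : ℝ → E} (hf : Continuous f) (n : ℕ) {s : ℝ}
    (hs : s ≠ 0) :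
    HasDerivAt (fun s => s • powAverage n f s) (f s - (n : ℝ) • powAverage n f s) s := by
  have hg : Continuous fun σ : ℝ => σ ^ n • f σ := by fun_prop
  have hI : HasDerivAt (fun s => ∫ σ in (0 : ℝ)..s, σ ^ n • f σ) (s ^ n • f s) s :=
    hg.integral_hasStrictDerivAt 0 s |>.hasDerivAt
  have heq : (fun s => s • powAverage n f s) =ᶠ[𝓝 s]
      fun s => (s ^ n)⁻¹ • ∫ σ in (0 : ℝ)..s, σ ^ n • f σ := by
    filter_upwards [isOpen_ne.mem_nhds hs] with t ht
    rw [← pow_smul_powAverage, pow_succ, mul_smul, inv_smul_smul₀ (pow_ne_zero n ht)]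
  have hcoeff : -(n * s ^ (n - 1)) / (s ^ n) ^ 2 * s ^ (n + 1) = -(n : ℝ) := by
    rcases n with _ | n
    · simp
    · rw [Nat.add_sub_cancel]
      field_simp
      ring
  refine ((((hasDerivAt_pow n s).fun_inv (pow_ne_zero n hs)).smul hI).congr_of_eventuallyEq
    heq).congr_deriv ?_
  rw [inv_smul_smul₀ (pow_ne_zero n hs), ← pow_smul_powAverage, smul_smul, hcoeff, neg_smul,
    sub_eq_add_neg]

lemma exists_eq_powAverage [CompleteSpace E] {n : ℕ} {N : ℝ → E → E}
    (hN : Continuous (Function.uncurry N)) {L : ℝ≥0} (hL : L < n + 1)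
    (hLip : ∀ s, LipschitzWith L (N s)) {B : ℝ} (hB : ∀ s, ‖N s 0‖ ≤ B) :
    ∃ p : ℝ →ᵇ E, ∀ s, p s = powAverage n (fun σ => N σ (p σ)) s := by
  have hcont (p : ℝ →ᵇ E) : Continuous fun σ => N σ (p σ) :=
    hN.comp (continuous_id.prodMk p.continuous)
  have hbound (p : ℝ →ᵇ E) (σ : ℝ) : ‖N σ (p σ)‖ ≤ B + L * ‖p‖ := by
    have hdist := (hLip σ).dist_le_mul (p σ) 0
    rw [dist_eq_norm, dist_zero_right] at hdist
    calc ‖N σ (p σ)‖ ≤ ‖N σ 0‖ + ‖N σ (p σ) - N σ 0‖ := norm_le_norm_add_norm_sub' _ _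
      _ ≤ B + L * ‖p‖ := by
        gcongr
        · exact hB σ
        · exact hdist.trans (by gcongr; exact p.norm_coe_le_norm σ)
  let T (p : ℝ →ᵇ E) : ℝ →ᵇ E :=
    BoundedContinuousFunction.ofNormedAddCommGroup (powAverage n fun σ => N σ (p σ))
      (continuous_powAverage (hcont p) n) _ (norm_powAverage_le (hbound p) n)
  have hT : ContractingWith (L / (n + 1)) T := by
    refine ⟨(div_lt_one (by positivity)).2 hL, LipschitzWith.of_dist_le_mul fun p r => ?_⟩
    refine (BoundedContinuousFunction.dist_le (by positivity)).2 fun s => ?_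
    have hpr (σ : ℝ) : ‖N σ (p σ) - N σ (r σ)‖ ≤ L * dist p r := by
      rw [← dist_eq_norm]
      exact ((hLip σ).dist_le_mul _ _).trans
        (by gcongr; exact BoundedContinuousFunction.dist_coe_le_dist σ)
    calc dist (T p s) (T r s)
        = ‖powAverage n (fun σ => N σ (p σ) - N σ (r σ)) s‖ := by
          rw [dist_eq_norm, powAverage_sub (hcont p) (hcont r)]
          rfl
      _ ≤ L * dist p r / (n + 1) := norm_powAverage_le hpr n s
      _ = (L / (n + 1) : ℝ≥0) * dist p r := by
          push_cast
          ring
  exact ⟨hT.fixedPoint T, fun s => congrArg (· s) hT.fixedPoint_isFixedPt.symm⟩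

end PowAverage

lemma div_add_mul_sub_mem_Icc {m M κ n w z : ℝ} (hκ : 0 < κ) (hm : 0 ≤ m) (hmM : m ≤ M)
    (hn : M / κ ^ 2 ≤ n) (hw : κ ≤ w) (hwz : w ≤ z) :
    m / z + n * z - (m / w + n * w) ∈ Icc 0 (n * (z - w)) := by
  have hw0 : 0 < w := hκ.trans_le hw
  have hz0 : 0 < z := hw0.trans_le hwz
  have hslope : m / (w * z) ≤ n := by
    refine le_trans ?_ hn
    rw [sq]
    gcongr
    · exact hm.trans hmM
    · exact hw.trans hwz
  have hfactor : m / z + n * z - (m / w + n * w) = (n - m / (w * z)) * (z - w) := by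
    field_simp
    ring
  rw [hfactor]
  exact ⟨mul_nonneg (sub_nonneg.2 hslope) (sub_nonneg.2 hwz),
    mul_le_mul_of_nonneg_right (sub_le_self _ (by positivity)) (sub_nonneg.2 hwz)⟩

lemma lipschitzWith_div_max_add_mul_max {m M κ c : ℝ} {n : ℕ} (hκ : 0 < κ) (hm : 0 ≤ m)
    (hmM : m ≤ M) (hn : M / κ ^ 2 ≤ n) :
    LipschitzWith n fun y => m / max κ y + n * max κ y - c := by
  refine LipschitzWith.of_le_add_mul _ fun y z => ?_
  have hmax := abs_max_sub_max_le_abs y z κ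
  rw [max_comm y, max_comm z] at hmax
  rw [Real.dist_eq, NNReal.coe_natCast]
  rcases le_total (max κ y) (max κ z) with h | h
  · have := (div_add_mul_sub_mem_Icc hκ hm hmM hn (le_max_left κ y) h).1
    have : 0 ≤ n * |y - z| := by positivity
    linarith
  · have := (div_add_mul_sub_mem_Icc hκ hm hmM hn (le_max_left κ z) h).2
    have : n * (max κ y - max κ z) ≤ n * |y - z| := by
      gcongr
      exact (le_abs_self _).trans hmax
    linarith

lemma exists_pos_mul_add_le (c : ℝ) {m₀ : ℝ} (hm₀ : 0 < m₀) : ∃ κ > 0, κ * (c + κ) ≤ m₀ := by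
  have hlim : Tendsto (fun κ : ℝ => κ * (c + κ)) (𝓝[>] 0) (𝓝 0) := by
    simpa using ((by fun_prop : Continuous fun κ : ℝ => κ * (c + κ)).tendsto 0).mono_left
      nhdsWithin_le_nhds
  obtain ⟨κ, hκm, hκ⟩ := ((hlim.eventually_le_const hm₀).and self_mem_nhdsWithin).exists
  exact ⟨κ, hκ, hκm⟩

lemma exists_eq_powAverage_cutoff {m : ℝ → ℝ} (hm : Continuous m) (hm0 : ∀ s, 0 ≤ m s) {M : ℝ}
    (hup : ∀ s, m s ≤ M) (c : ℝ) {κ : ℝ} (hκ : 0 < κ) {n : ℕ} (hn : M / κ ^ 2 ≤ n) :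
    ∃ p : ℝ →ᵇ ℝ, ∀ s,
      p s = powAverage n (fun σ => m σ / max κ (p σ) + n * max κ (p σ) - c) s := by
  let N (s y : ℝ) : ℝ := m s / max κ y + n * max κ y - c
  have hNcont : Continuous (Function.uncurry N) := by
    have hmax (z : ℝ × ℝ) : max κ z.2 ≠ 0 := (lt_max_of_lt_left hκ).ne'
    simp only [N, Function.uncurry_def]
    fun_prop (disch := exact hmax _)
  have hNzero (s : ℝ) : ‖N s 0‖ ≤ M / κ + n * κ + |c| := by
    simp only [N, max_eq_left hκ.le]
    refine (norm_sub_le _ _).trans ?_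
    rw [Real.norm_of_nonneg (add_nonneg (div_nonneg (hm0 s) hκ.le) (by positivity)),
      Real.norm_eq_abs]
    gcongr
    exact hup s
  exact exists_eq_powAverage (N := N) hNcont (L := n) (by simp)
    (fun s => lipschitzWith_div_max_add_mul_max hκ (hm0 s) (hup s) hn) hNzero

-- The equation for `p` reads `s p' + (n + 1) p = m / p - c + n p`. Cutting `p` off below at `κ`
-- makes the right-hand side Lipschitz with constant `n < n + 1` for large `n`, and the solution
-- never falls below the cut-off because the right-hand side is at least `(n + 1) κ`.
lemma exists_singular_profile {m : ℝ → ℝ} (hm : Continuous m) {m₀ M : ℝ} (hm₀ : 0 < m₀)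
    (hlow : ∀ s, m₀ ≤ m s) (hup : ∀ s, m s ≤ M) (c : ℝ) :
    ∃ p : ℝ →ᵇ ℝ, (∀ s, 0 < p s) ∧
      ∀ s ≠ 0, HasDerivAt (fun s => s * p s) (m s / p s - c) s := by
  obtain ⟨κ, hκ, hκm⟩ := exists_pos_mul_add_le c hm₀
  obtain ⟨n, hn⟩ := exists_nat_ge (M / κ ^ 2)
  have hm0 (s : ℝ) : 0 ≤ m s := hm₀.le.trans (hlow s)
  obtain ⟨p, hp⟩ := exists_eq_powAverage_cutoff hm hm0 hup c hκ hn
  have hcont : Continuous fun σ => m σ / max κ (p σ) + n * max κ (p σ) - c := by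
    have hmax (σ : ℝ) : max κ (p σ) ≠ 0 := (lt_max_of_lt_left hκ).ne'
    fun_prop (disch := exact hmax _)
  have hlow_cutoff (σ : ℝ) : (n + 1) * κ ≤ m σ / max κ (p σ) + n * max κ (p σ) - c := by
    have hmono := (div_add_mul_sub_mem_Icc hκ (hm0 σ) (hup σ) hn le_rfl (le_max_left κ (p σ))).1
    have hend : c + κ ≤ m σ / κ := (le_div_iff₀' hκ).2 (hκm.trans (hlow σ))
    linarith
  have hpκ (s : ℝ) : κ ≤ p s := by
    calc κ = powAverage n (fun _ => (n + 1) * κ) s := by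
          rw [powAverage_const]
          field_simp
      _ ≤ powAverage n (fun σ => m σ / max κ (p σ) + n * max κ (p σ) - c) s :=
          powAverage_mono continuous_const hcont hlow_cutoff n s
      _ = p s := (hp s).symm
  refine ⟨p, fun s => hκ.trans_le (hpκ s), fun s hs => ?_⟩
  have hderiv := hasDerivAt_smul_powAverage hcont n hs
  simp only [← hp, smul_eq_mul] at hderiv
  refine hderiv.congr_deriv ?_
  rw [max_eq_right (hpκ s)]
  ring

end SingularEquation

section Separatrix

open scoped BoundedContinuousFunction

/-- The separatrix of the equilibrium `(θp, 0)` of `u' = v, v' = c v - F(u)`, written as the graph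
of a positive function `v` of the distance `s = θp - u ∈ (0, a]` to the equilibrium; here
`f s = F (θp - s)`. -/
structure IsSeparatrixProfile (f : ℝ → ℝ) (c a : ℝ) (v : ℝ → ℝ) : Prop where
  pos : ∀ s ∈ Ioc 0 a, 0 < v s
  hasDerivAt : ∀ s ∈ Ioc 0 a, HasDerivAt v (f s / v s - c) s
  tendsto_zero : Tendsto v (𝓝[>] 0) (𝓝 0)

lemma surjective_of_le_deriv {f : ℝ → ℝ} (hf : Differentiable ℝ f) {δ : ℝ} (hδ : 0 < δ)
    (hderiv : ∀ x, δ ≤ deriv f x) : Function.Surjective f := by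
  have hgrowth := mul_sub_le_image_sub_of_le_deriv hf hderiv
  refine hf.continuous.surjective ?_ ?_
  · refine tendsto_atTop_mono' _ ?_ (tendsto_atTop_add_const_left _ (f 0)
      (tendsto_id.const_mul_atTop hδ))
    filter_upwards [eventually_ge_atTop 0] with x hx
    have := hgrowth hx
    simp only [id]
    linarith
  · refine tendsto_atBot_mono' _ ?_ (tendsto_atBot_add_const_left _ (f 0)
      (tendsto_id.const_mul_atBot hδ))
    filter_upwards [eventually_le_atBot 0] with x hx
    have := hgrowth hx
    simp only [id]
    linarith

-- Separation of variables: the solution is the inverse of `y ↦ ∫₀ʸ dx / g x`.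
lemma exists_orderIso_hasDerivAt {g : ℝ → ℝ} (hg : Continuous g) (hpos : ∀ y, 0 < g y) {K : ℝ}
    (hup : ∀ y, g y ≤ K) : ∃ Y : ℝ ≃o ℝ, Y 0 = 0 ∧ ∀ t, HasDerivAt Y (g (Y t)) t := by
  have hK : 0 < K := (hpos 0).trans_le (hup 0)
  have hgi : Continuous fun y => (g y)⁻¹ := hg.inv₀ fun y => (hpos y).ne'
  let T (y : ℝ) : ℝ := ∫ x in (0 : ℝ)..y, (g x)⁻¹
  have hT (y : ℝ) : HasDerivAt T (g y)⁻¹ y := (hgi.integral_hasStrictDerivAt 0 y).hasDerivAt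
  have hmono : StrictMono T := strictMono_of_deriv_pos fun y => by
    rw [(hT y).deriv]
    exact inv_pos.2 (hpos y)
  have hsurj : Function.Surjective T :=
    surjective_of_le_deriv (fun y => (hT y).differentiableAt) (inv_pos.2 hK) fun y => by
      rw [(hT y).deriv]
      exact inv_anti₀ (hpos y) (hup y)
  let e := hmono.orderIsoOfSurjective T hsurj
  refine ⟨e.symm, ?_, fun t => ?_⟩
  · rw [OrderIso.symm_apply_eq]
    exact intervalIntegral.integral_same.symm
  · simpa only [inv_inv] using HasDerivAt.of_local_left_inverse
      e.symm.continuous.continuousAt (hT (e.symm t)) (inv_ne_zero (hpos _).ne')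
      (Eventually.of_forall e.apply_symm_apply)

lemma exists_decaying_solution {p : ℝ → ℝ} (hp : Continuous p) (hpos : ∀ s, 0 < p s) {K : ℝ}
    (hup : ∀ s, p s ≤ K) {a : ℝ} (ha : 0 < a) :
    ∃ S : ℝ → ℝ, S 0 = a ∧ (∀ t, 0 ≤ t → S t ∈ Ioc 0 a) ∧ Tendsto S atTop (𝓝 0) ∧
      ∀ t, HasDerivAt S (-(S t * p (S t))) t := by
  obtain ⟨Y, hY0, hY⟩ := exists_orderIso_hasDerivAt (g := fun y => p (a * Real.exp (-y)))
    (by fun_prop) (fun _ => hpos _) (fun _ => hup _)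
  refine ⟨fun t => a * Real.exp (-Y t), by simp [hY0], fun t ht => ⟨by positivity, ?_⟩, ?_,
    fun t => ?_⟩
  · have hYt : 0 ≤ Y t := hY0 ▸ Y.monotone ht
    exact mul_le_of_le_one_right ha.le (Real.exp_le_one_iff.2 (neg_nonpos.2 hYt))
  · simpa using (Real.tendsto_exp_neg_atTop_nhds_zero.comp Y.tendsto_atTop).const_mul a
  · exact (((hY t).fun_neg.exp).const_mul a).congr_deriv (by ring)

-- The factor `s` in `v s = s * p s` is what makes the motion take infinite time to reach the
-- equilibrium.
lemma IsSeparatrixProfile.mem_stableSeparatrix {F : ℝ → ℝ} {c a θp : ℝ} {p : ℝ →ᵇ ℝ}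
    (h : IsSeparatrixProfile (fun s => F (θp - s)) c a fun s => s * p s) (hp : ∀ s, 0 < p s)
    (ha : 0 < a) : (θp - a, a * p a) ∈ stableSeparatrix F c (θp - a) θp := by
  obtain ⟨S, hS0, hSmem, hSlim, hS⟩ := exists_decaying_solution p.continuous hp
    (fun s => (le_abs_self _).trans (p.norm_coe_le_norm s)) ha
  refine ⟨fun t => θp - S t, fun t => S t * p (S t), fun t ht => ⟨?_, ?_⟩, by simp [hS0],
    fun t ht => ?_, by simpa using hSlim.const_sub θp, ?_⟩
  · simpa using ((hS t).const_sub θp).hasDerivWithinAt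
  · refine (((h.hasDerivAt _ (hSmem t ht)).comp t (hS t)).congr_deriv ?_).hasDerivWithinAt
    rw [mul_neg, sub_mul, div_mul_cancel₀ _ (h.pos _ (hSmem t ht)).ne', neg_sub]
  · have hSt := hSmem t ht
    exact ⟨⟨sub_le_sub_left hSt.2 θp, sub_le_self θp hSt.1.le⟩, (h.pos _ hSt).le⟩
  · simpa using hSlim.mul ((p.continuous.tendsto 0).comp hSlim)

theorem exists_isSeparatrixProfile {F m : ℝ → ℝ} {a θp : ℝ} (ha : 0 < a)
    (hm : ContinuousOn m (Icc 0 a)) (hpos : ∀ s ∈ Icc 0 a, 0 < m s)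
    (hF : ∀ s ∈ Ioc 0 a, F (θp - s) = s * m s) (c : ℝ) :
    ∃ v, IsSeparatrixProfile (fun s => F (θp - s)) c a v ∧
      (θp - a, v a) ∈ stableSeparatrix F c (θp - a) θp := by
  have hne : (Icc 0 a).Nonempty := nonempty_Icc.2 ha.le
  obtain ⟨s₀, hs₀, hmin⟩ := isCompact_Icc.exists_isMinOn hne hm
  obtain ⟨s₁, -, hmax⟩ := isCompact_Icc.exists_isMaxOn hne hm
  obtain ⟨p, hp, hderiv⟩ := exists_singular_profile
    (m := IccExtend ha.le (domRestrict (Icc 0 a) m)) hm.domRestrict.Icc_extend' (hpos s₀ hs₀)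
    (fun s => hmin (projIcc 0 a ha.le s).2) (fun s => hmax (projIcc 0 a ha.le s).2) c
  have hv : IsSeparatrixProfile (fun s => F (θp - s)) c a fun s => s * p s := by
    refine ⟨fun s hs => mul_pos hs.1 (hp s), fun s hs => ?_, ?_⟩
    · convert hderiv s hs.1.ne' using 2
      rw [hF s hs, mul_div_mul_left _ _ hs.1.ne', IccExtend_of_mem _ _ (Ioc_subset_Icc_self hs)]
      rfl
    · simpa using ((by fun_prop : Continuous fun s => s * p s).tendsto 0).mono_left
        nhdsWithin_le_nhds
  exact ⟨_, hv, hv.mem_stableSeparatrix hp ha⟩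

lemma nonpos_of_deriv_nonpos_of_pos {D D' : ℝ → ℝ} {a : ℝ} (ha : 0 < a)
    (hD : ∀ s ∈ Ioc 0 a, HasDerivAt D (D' s) s) (hlim : Tendsto D (𝓝[>] 0) (𝓝 0))
    (hneg : ∀ s ∈ Ioc 0 a, 0 < D s → D' s ≤ 0) : D a ≤ 0 := by
  have hbound (ε : ℝ) (hε : 0 < ε) : D a ≤ ε * (1 + a) := by
    obtain ⟨s₀, hDs₀, hs₀⟩ := ((hlim.eventually_le_const hε).and (Ioc_mem_nhdsGT ha)).exists
    have hsub {s : ℝ} (hs : s ∈ Icc s₀ a) : s ∈ Ioc 0 a := ⟨hs₀.1.trans_le hs.1, hs.2⟩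
    refine image_le_of_deriv_right_lt_deriv_boundary (B := fun s => ε * (1 + s))
      (fun s hs => (hD s (hsub hs)).continuousAt.continuousWithinAt)
      (fun s hs => (hD s (hsub (Ico_subset_Icc_self hs))).hasDerivWithinAt)
      (hDs₀.trans (le_mul_of_one_le_right hε.le (le_add_of_nonneg_right hs₀.1.le)))
      (fun s => ((hasDerivAt_id s).const_add 1).const_mul ε) (fun s hs heq => ?_)
      (right_mem_Icc.2 hs₀.2)
    have hs' := hsub (Ico_subset_Icc_self hs)
    have hDs : 0 < D s := heq ▸ mul_pos hε (add_pos one_pos hs'.1)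
    rw [mul_one]
    exact (hneg s hs' hDs).trans_lt hε
  have hlim0 : Tendsto (fun ε : ℝ => ε * (1 + a)) (𝓝[>] 0) (𝓝 0) := by
    simpa using ((by fun_prop : Continuous fun ε : ℝ => ε * (1 + a)).tendsto 0).mono_left
      nhdsWithin_le_nhds
  exact ge_of_tendsto hlim0 (eventually_mem_nhdsWithin.mono hbound)

namespace IsSeparatrixProfile

variable {f v₁ v₂ : ℝ → ℝ} {c₁ c₂ a : ℝ}

lemma le_of_speed_le (h₁ : IsSeparatrixProfile f c₁ a v₁) (h₂ : IsSeparatrixProfile f c₂ a v₂)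
    (ha : 0 < a) (hf : ∀ s ∈ Ioc 0 a, 0 ≤ f s) (hc : c₁ ≤ c₂) : v₂ a ≤ v₁ a := by
  refine sub_nonpos.1 (nonpos_of_deriv_nonpos_of_pos (D := fun s => v₂ s - v₁ s) ha
    (fun s hs => (h₂.hasDerivAt s hs).sub (h₁.hasDerivAt s hs))
    (by simpa using h₂.tendsto_zero.sub h₁.tendsto_zero) fun s hs hpos => ?_)
  have := div_le_div_of_nonneg_left (hf s hs) (h₁.pos s hs) (sub_pos.1 hpos).le
  linarith

lemma sub_le_of_speed_le (h₁ : IsSeparatrixProfile f c₁ a v₁)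
    (h₂ : IsSeparatrixProfile f c₂ a v₂) (ha : 0 < a) (hf : ∀ s ∈ Ioc 0 a, 0 ≤ f s)
    (hc : c₁ ≤ c₂) : v₁ a - v₂ a ≤ (c₂ - c₁) * a := by
  have hlin : Tendsto (fun s : ℝ => (c₂ - c₁) * s) (𝓝[>] 0) (𝓝 0) := by
    simpa using ((by fun_prop : Continuous fun s : ℝ => (c₂ - c₁) * s).tendsto 0).mono_left
      nhdsWithin_le_nhds
  refine sub_nonpos.1 (nonpos_of_deriv_nonpos_of_pos
    (D := fun s => v₁ s - v₂ s - (c₂ - c₁) * s) ha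
    (fun s hs => ((h₁.hasDerivAt s hs).sub (h₂.hasDerivAt s hs)).sub
      ((hasDerivAt_id s).const_mul (c₂ - c₁)))
    (by simpa using (h₁.tendsto_zero.sub h₂.tendsto_zero).sub hlin) fun s hs hpos => ?_)
  have hle : v₂ s ≤ v₁ s := by
    have := mul_nonneg (sub_nonneg.2 hc) hs.1.le
    linarith
  have := div_le_div_of_nonneg_left (hf s hs) (h₂.pos s hs) hle
  linarith

end IsSeparatrixProfile

theorem exists_antitone_mem_stableSeparatrix {F m : ℝ → ℝ} {a θp : ℝ} (ha : 0 < a)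
    (hm : ContinuousOn m (Icc 0 a)) (hpos : ∀ s ∈ Icc 0 a, 0 < m s)
    (hF : ∀ s ∈ Ioc 0 a, F (θp - s) = s * m s) :
    ∃ V : ℝ → ℝ, (∀ c, 0 < V c) ∧ Antitone V ∧ LipschitzWith a.toNNReal V ∧
      ∀ c, (θp - a, V c) ∈ stableSeparatrix F c (θp - a) θp := by
  choose v hv hmem using exists_isSeparatrixProfile ha hm hpos hF
  have hf (s : ℝ) (hs : s ∈ Ioc 0 a) : 0 ≤ F (θp - s) :=
    hF s hs ▸ mul_nonneg hs.1.le (hpos s (Ioc_subset_Icc_self hs)).le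
  have hanti : Antitone fun c => v c a := fun c d hcd => (hv c).le_of_speed_le (hv d) ha hf hcd
  refine ⟨fun c => v c a, fun c => (hv c).pos a (right_mem_Ioc.2 ha), hanti,
    LipschitzWith.of_le_add_mul _ fun c d => ?_, hmem⟩
  rw [Real.coe_toNNReal a ha.le, Real.dist_eq]
  rcases le_total c d with hcd | hdc
  · have := (hv c).sub_le_of_speed_le (hv d) ha hf hcd
    rw [abs_of_nonpos (sub_nonpos.2 hcd)]
    linarith
  · exact (hanti hdc).trans (le_add_of_nonneg_right (by positivity))

section Uniqueness

variable {F u₁ v₁ u₂ v₂ : ℝ → ℝ} {c : ℝ}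

lemma hasDerivWithinAt_exp_neg_mul_sub_mul_sub (h₁ : IsForwardTrajectory F c u₁ v₁)
    (h₂ : IsForwardTrajectory F c u₂ v₂) {t : ℝ} (ht : 0 ≤ t) :
    HasDerivWithinAt (fun t => Real.exp (-c * t) * ((u₁ t - u₂ t) * (v₁ t - v₂ t)))
      (Real.exp (-c * t) * ((v₁ t - v₂ t) ^ 2 - (u₁ t - u₂ t) * (F (u₁ t) - F (u₂ t))))
      (Ici 0) t := by
  have hexp := (((hasDerivAt_id t).const_mul (-c)).exp).hasDerivWithinAt (s := Ici 0)
  refine (hexp.mul (((h₁ t ht).1.fun_sub (h₂ t ht).1).fun_mul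
    ((h₁ t ht).2.fun_sub (h₂ t ht).2))).congr_deriv ?_
  simp only [id]
  ring

lemma monotoneOn_exp_neg_mul_sub_mul_sub {J : Set ℝ} (hF : AntitoneOn F J)
    (h₁ : IsForwardTrajectory F c u₁ v₁) (h₂ : IsForwardTrajectory F c u₂ v₂)
    (hu₁ : ∀ t, 0 ≤ t → u₁ t ∈ J) (hu₂ : ∀ t, 0 ≤ t → u₂ t ∈ J) :
    MonotoneOn (fun t => Real.exp (-c * t) * ((u₁ t - u₂ t) * (v₁ t - v₂ t))) (Ici 0) := by
  have hderiv (t : ℝ) (ht : 0 ≤ t) := hasDerivWithinAt_exp_neg_mul_sub_mul_sub h₁ h₂ ht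
  refine monotoneOn_of_hasDerivWithinAt_nonneg (convex_Ici 0)
    (fun t ht => (hderiv t ht).continuousWithinAt)
    (fun t ht => (hderiv t (interior_subset ht)).mono interior_subset) fun t ht => ?_
  have ht0 : 0 ≤ t := interior_subset ht
  have hFle : (u₁ t - u₂ t) * (F (u₁ t) - F (u₂ t)) ≤ 0 := by
    rcases le_total (u₁ t) (u₂ t) with h | h
    · exact mul_nonpos_of_nonpos_of_nonneg (sub_nonpos.2 h)
        (sub_nonneg.2 (hF (hu₁ t ht0) (hu₂ t ht0) h))
    · exact mul_nonpos_of_nonneg_of_nonpos (sub_nonneg.2 h)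
        (sub_nonpos.2 (hF (hu₂ t ht0) (hu₁ t ht0) h))
  exact mul_nonneg (Real.exp_pos _).le (sub_nonneg.2 (hFle.trans (sq_nonneg _)))

lemma eq_of_monotoneOn_of_tendsto_atTop {f : ℝ → ℝ} {a : ℝ} (hf : MonotoneOn f (Ici a))
    (hlim : Tendsto f atTop (𝓝 (f a))) {t : ℝ} (ht : a ≤ t) : f t = f a := by
  refine le_antisymm (ge_of_tendsto hlim ?_) (hf self_mem_Ici ht ht)
  filter_upwards [eventually_ge_atTop t] with r hr
  exact hf ht (ht.trans hr) hr

end Uniqueness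

theorem stableSeparatrix_unique {F : ℝ → ℝ} {c x θhl θp w₁ w₂ : ℝ} (hc : 0 < c)
    (hF : AntitoneOn F (Icc θhl θp)) (h₁ : (x, w₁) ∈ stableSeparatrix F c θhl θp)
    (h₂ : (x, w₂) ∈ stableSeparatrix F c θhl θp) : w₁ = w₂ := by
  obtain ⟨u₁, v₁, htraj₁, hstart₁, hstrip₁, hu₁, hv₁⟩ := h₁
  obtain ⟨u₂, v₂, htraj₂, hstart₂, hstrip₂, hu₂, hv₂⟩ := h₂
  obtain ⟨hu₁0, rfl⟩ := Prod.mk.inj hstart₁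
  obtain ⟨hu₂0, rfl⟩ := Prod.mk.inj hstart₂
  let P (t : ℝ) : ℝ := Real.exp (-c * t) * ((u₁ t - u₂ t) * (v₁ t - v₂ t))
  have hP0 : P 0 = 0 := by simp [P, hu₁0, hu₂0]
  have hPlim : Tendsto P atTop (𝓝 (P 0)) := by
    have hexp : Tendsto (fun t : ℝ => Real.exp (-c * t)) atTop (𝓝 0) :=
      Real.tendsto_exp_atBot.comp (tendsto_id.const_mul_atTop_of_neg (neg_lt_zero.2 hc))
    rw [hP0]
    simpa [P] using hexp.mul ((hu₁.sub hu₂).mul (hv₁.sub hv₂))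
  have hPmono : MonotoneOn P (Ici 0) := monotoneOn_exp_neg_mul_sub_mul_sub hF htraj₁ htraj₂
    (fun t ht => (hstrip₁ t ht).1) fun t ht => (hstrip₂ t ht).1
  have hPconst (t : ℝ) (ht : t ∈ Ici 0) : P t = P 0 :=
    eq_of_monotoneOn_of_tendsto_atTop hPmono hPlim ht
  have hderiv0 : HasDerivWithinAt P 0 (Ici 0) 0 :=
    (hasDerivWithinAt_const 0 (Ici 0) (P 0)).congr hPconst rfl
  have hsq := (uniqueDiffOn_Ici (0 : ℝ) 0 self_mem_Ici).eq_deriv _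
    (hasDerivWithinAt_exp_neg_mul_sub_mul_sub htraj₁ htraj₂ le_rfl) hderiv0
  simpa [hu₁0, hu₂0, sub_eq_zero] using hsq

end Separatrix

section MonotoneGraphs

lemma strictMonoOn_invFunOn {α β : Type*} [LinearOrder α] [Preorder β] [Nonempty α] {f : α → β}
    {s : Set α} (hf : StrictMonoOn f s) : StrictMonoOn (Function.invFunOn f s) (f '' s) := by
  rintro _ ⟨x, hx, rfl⟩ _ ⟨y, hy, rfl⟩ hxy
  rw [hf.injOn.leftInvOn_invFunOn hx, hf.injOn.leftInvOn_invFunOn hy]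
  exact (hf.lt_iff_lt hx hy).1 hxy

lemma continuousOn_invFunOn {α β : Type*} [LinearOrder α] [TopologicalSpace α] [OrderTopology α]
    [LinearOrder β] [TopologicalSpace β] [OrderTopology β] [Nonempty α] {f : α → β} {s : Set α}
    [s.OrdConnected] [(f '' s).OrdConnected] (hf : StrictMonoOn f s) :
    ContinuousOn (Function.invFunOn f s) (f '' s) := by
  let e := hf.orderIso f s
  rw [continuousOn_iff_continuous_domRestrict]
  refine (continuous_subtype_val.comp e.symm.continuous).congr fun y => ?_
  obtain ⟨x, rfl⟩ := e.surjective y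
  rw [Function.comp_apply, e.symm_apply_apply]
  exact (hf.injOn.leftInvOn_invFunOn x.2).symm

lemma image_prodMk_eq_graphOn {ι α β : Type*} [Nonempty ι] {r : ι → α} {C : ι → β} {s : Set ι}
    (hr : InjOn r s) :
    (fun x => (r x, C x)) '' s = (r '' s).graphOn (C ∘ Function.invFunOn r s) := by
  rw [graphOn, image_image]
  refine image_congr fun x hx => ?_
  rw [Function.comp_apply, hr.leftInvOn_invFunOn hx]

variable {l y ρ : ℝ} {r : ℝ → ℝ}

lemma image_Ioc_of_tendsto (hly : l < y) (hcont : ContinuousOn r (Ioc l y))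
    (hmono : StrictMonoOn r (Ioc l y)) (hlim : Tendsto r (𝓝[>] l) (𝓝 ρ)) :
    r '' Ioc l y = Ioc ρ (r y) := by
  have hy : y ∈ Ioc l y := right_mem_Ioc.2 hly
  have hle : 𝓝[>] l ≤ 𝓟 (Ioc l y) := le_principal_iff.2 (Ioc_mem_nhdsGT hly)
  refine Subset.antisymm ?_ (isPreconnected_Ioc.intermediate_value_Ioc hy hle hcont hlim)
  rintro _ ⟨x, hx, rfl⟩
  refine ⟨?_, hmono.monotoneOn hx hy hx.2⟩
  obtain ⟨w, hlw, hwx⟩ := exists_between hx.1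
  have hw : w ∈ Ioc l y := ⟨hlw, hwx.le.trans hx.2⟩
  refine (le_of_tendsto hlim ?_).trans_lt (hmono hw hx hwx)
  filter_upwards [Ioc_mem_nhdsGT hlw] with z hz
  exact hmono.monotoneOn ⟨hz.1, hz.2.trans hw.2⟩ hw hz.2

lemma tendsto_invFunOn_nhdsGT (hly : l < y) (hmono : StrictMonoOn r (Ioc l y))
    (himage : r '' Ioc l y = Ioc ρ (r y)) :
    Tendsto (Function.invFunOn r (Ioc l y)) (𝓝[>] ρ) (𝓝[>] l) := by
  refine (nhdsGT_basis l).tendsto_right_iff.2 fun b hb => ?_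
  obtain ⟨x, hlx, hxb⟩ := exists_between (lt_min hb hly)
  have hx : x ∈ Ioc l y := ⟨hlx, (hxb.trans_le (min_le_right b y)).le⟩
  have hrx : r x ∈ Ioc ρ (r y) := himage ▸ mem_image_of_mem r hx
  filter_upwards [Ioc_mem_nhdsGT hrx.1] with z hz
  obtain ⟨w, hw, rfl⟩ : z ∈ r '' Ioc l y := himage ▸ ⟨hz.1, hz.2.trans hrx.2⟩
  rw [hmono.injOn.leftInvOn_invFunOn hw]
  exact ⟨hw.1, ((hmono.le_iff_le hw hx).1 hz.2).trans_lt (hxb.trans_le (min_le_left b y))⟩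

theorem exists_graphOn_eq_image_prodMk {C : ℝ → ℝ} (hly : l < y)
    (hr : ContinuousOn r (Ioc l y)) (hr_mono : StrictMonoOn r (Ioc l y))
    (hr_lim : Tendsto r (𝓝[>] l) (𝓝 ρ)) (hC : ContinuousOn C (Ioc l y))
    (hC_anti : StrictAntiOn C (Ioc l y)) (hC_lim : Tendsto C (𝓝[>] l) atTop) :
    ∃ φ : ℝ → ℝ, (fun x => (r x, C x)) '' Ioc l y = (Ioc ρ (r y)).graphOn φ ∧
      ContinuousOn φ (Ioc ρ (r y)) ∧ StrictAntiOn φ (Ioc ρ (r y)) ∧ φ (r y) = C y ∧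
      Tendsto φ (𝓝[>] ρ) atTop := by
  have himage := image_Ioc_of_tendsto hly hr hr_mono hr_lim
  have : (r '' Ioc l y).OrdConnected := himage ▸ ordConnected_Ioc
  have hmaps : MapsTo (Function.invFunOn r (Ioc l y)) (r '' Ioc l y) (Ioc l y) :=
    (surjOn_image r (Ioc l y)).mapsTo_invFunOn
  refine ⟨C ∘ Function.invFunOn r (Ioc l y), ?_, ?_, ?_, ?_, ?_⟩
  · rw [image_prodMk_eq_graphOn hr_mono.injOn, himage]
  · exact himage ▸ hC.comp (continuousOn_invFunOn hr_mono) hmaps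
  · exact himage ▸ hC_anti.comp_strictMonoOn (strictMonoOn_invFunOn hr_mono) hmaps
  · exact congrArg C (hr_mono.injOn.leftInvOn_invFunOn (right_mem_Ioc.2 hly))
  · exact hC_lim.comp (tendsto_invFunOn_nhdsGT hly hr_mono himage)

theorem exists_graphOn_inter_graphOn_eq_singleton {a b : ℝ} {φ ψ : ℝ → ℝ} {s : Set ℝ}
    (hab : a < b) (hs : Ioc a b ⊆ s) (hφ : ContinuousOn φ (Ioc a b))
    (hφ_anti : StrictAntiOn φ (Ioc a b)) (hφ_lim : Tendsto φ (𝓝[>] a) atTop)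
    (hψ : ContinuousOn ψ s) (hψ_mono : MonotoneOn ψ s) (hb : φ b ≤ ψ b) :
    ∃ x ∈ Ioc a b, (Ioc a b).graphOn φ ∩ s.graphOn ψ = {(x, ψ x)} := by
  have hb_mem : b ∈ Ioc a b := right_mem_Ioc.2 hab
  have hanti : StrictAntiOn (fun x => φ x + -ψ x) (Ioc a b) :=
    hφ_anti.add_antitone (hψ_mono.mono hs).neg
  have hlim : Tendsto (fun x => φ x + -ψ x) (𝓝[>] a) atTop := by
    refine tendsto_atTop_add_right_of_le' _ (-ψ b) hφ_lim ?_
    filter_upwards [Ioc_mem_nhdsGT hab] with x hx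
    exact neg_le_neg (hψ_mono (hs hx) (hs hb_mem) hx.2)
  have hle : 𝓝[>] a ≤ 𝓟 (Ioc a b) := le_principal_iff.2 (Ioc_mem_nhdsGT hab)
  obtain ⟨x, hx, hx0⟩ := isPreconnected_Ioc.intermediate_value_Ici hb_mem hle
    (hφ.add (hψ.mono hs).neg) hlim (show φ b + -ψ b ≤ 0 by linarith)
  have heq : φ x = ψ x := add_neg_eq_zero.1 hx0
  refine ⟨x, hx, Subset.antisymm ?_ ?_⟩
  · rintro ⟨z, w⟩ ⟨hzφ, hzψ⟩
    rw [mem_graphOn] at hzφ hzψ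
    have hzx : z = x := hanti.injOn hzφ.1 hx (by
      simp only [hzφ.2, hzψ.2, heq, add_neg_cancel])
    exact Prod.ext hzx (by rw [← hzψ.2, hzx])
  · rintro _ rfl
    exact ⟨mem_graphOn.2 ⟨hx, heq⟩, mem_graphOn.2 ⟨hs hx, rfl⟩⟩

end MonotoneGraphs

section LevelSet

variable {q α β x y : ℝ}

/-- Up to a positive factor, `c - q R / β` at the point of the level set with `c R = x`. -/
noncomputable def endpointGap (α β x : ℝ) : ℝ := β * (1 - Real.exp (-x)) - α * x

/-- The value of `c ^ 2 / q` forced by `transG q α β R c = 0` at `c R = x`. -/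
noncomputable def speedSq (α β x : ℝ) : ℝ := (Real.exp x - 1 - x) / (α * Real.exp x - β)

/-- The speed `c` at the point of the level set with `c R = x`. -/
noncomputable def levelSpeed (q α β x : ℝ) : ℝ := √(q * speedSq α β x)

/-- The radius `R` at the point of the level set with `c R = x`. -/
noncomputable def levelRadius (q α β x : ℝ) : ℝ := x / levelSpeed q α β x

lemma exp_sub_one_sub_pos (hx : x ≠ 0) : 0 < Real.exp x - 1 - x := by
  linarith [Real.add_one_lt_exp hx]

lemma mul_exp_sub_pos_iff (hα : 0 < α) (hβ : 0 < β) :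
    0 < α * Real.exp x - β ↔ Real.log (β / α) < x := by
  rw [Real.log_lt_iff_lt_exp (by positivity), div_lt_iff₀ hα, sub_pos, mul_comm]

lemma log_div_pos (hα : 0 < α) (hαβ : α < β) : 0 < Real.log (β / α) :=
  Real.log_pos ((one_lt_div hα).2 hαβ)

lemma endpointGap_zero : endpointGap α β 0 = 0 := by
  simp [endpointGap]

lemma strictConcaveOn_endpointGap (hβ : 0 < β) :
    StrictConcaveOn ℝ univ (endpointGap α β) := by
  have hderiv (x : ℝ) : HasDerivAt (endpointGap α β) (β * Real.exp (-x) - α) x := by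
    refine (((hasDerivAt_neg x).exp.const_sub 1).const_mul β |>.fun_sub
      ((hasDerivAt_id x).const_mul α)).congr_deriv ?_
    ring
  refine StrictAnti.strictConcaveOn_univ_of_deriv
    (continuous_iff_continuousAt.2 fun x => (hderiv x).continuousAt) fun x z hxz => ?_
  rw [(hderiv x).deriv, (hderiv z).deriv]
  gcongr

lemma endpointGap_pos_of_lt (hβ : 0 < β) (hx : 0 < x) (hxy : x < y)
    (hy : 0 ≤ endpointGap α β y) : 0 < endpointGap α β x := by
  have hxmem : x ∈ openSegment ℝ 0 y := by
    rw [openSegment_eq_Ioo (hx.trans hxy)]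
    exact ⟨hx, hxy⟩
  have hmin := (strictConcaveOn_endpointGap (α := α) hβ).lt_on_openSegment (mem_univ 0)
    (mem_univ y) (hx.trans hxy).ne hxmem
  rwa [endpointGap_zero, min_eq_left hy] at hmin

lemma endpointGap_nonneg_iff (hβ : 0 < β) (hx : 0 < x) (hy0 : 0 < y)
    (hy : endpointGap α β y = 0) : 0 ≤ endpointGap α β x ↔ x ≤ y := by
  refine ⟨fun h => ?_, fun h => ?_⟩
  · by_contra! hyx
    exact (endpointGap_pos_of_lt hβ hy0 hyx h).ne' hy
  · rcases h.lt_or_eq with hlt | rfl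
    · exact (endpointGap_pos_of_lt hβ hx hlt hy.ge).le
    · exact hy.ge

lemma exists_endpointGap_eq_zero (hα : 0 < α) (hαβ : α < β) :
    ∃ y, Real.log (β / α) < y ∧ endpointGap α β y = 0 := by
  have hβ : 0 < β := hα.trans hαβ
  have hratio : 1 < β / α := (one_lt_div hα).2 hαβ
  have hlog := Real.log_lt_sub_one_of_pos (zero_lt_one.trans hratio) hratio.ne'
  have hpos : 0 < endpointGap α β (Real.log (β / α)) := by
    have hgap : endpointGap α β (Real.log (β / α)) = α * (β / α - 1 - Real.log (β / α)) := by
      rw [endpointGap, Real.exp_neg, Real.exp_log (by positivity)]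
      field_simp
    rw [hgap]
    exact mul_pos hα (sub_pos.2 hlog)
  have hneg : endpointGap α β (β / α) < 0 := by
    have hgap : endpointGap α β (β / α) = -(β * Real.exp (-(β / α))) := by
      rw [endpointGap, mul_div_cancel₀ _ hα.ne']
      ring
    rw [hgap]
    exact neg_lt_zero.2 (by positivity)
  have hcont : Continuous (endpointGap α β) := by
    unfold endpointGap
    fun_prop
  obtain ⟨y, hy, hy0⟩ := intermediate_value_Ioo' (hlog.trans (sub_one_lt _)).le hcont.continuousOn
    ⟨hneg, hpos⟩
  exact ⟨y, hy.1, hy0⟩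

lemma mul_speedSq_sub_self (hx : α * Real.exp x - β ≠ 0) :
    β * speedSq α β x - x = Real.exp x / (α * Real.exp x - β) * endpointGap α β x := by
  rw [speedSq, endpointGap, Real.exp_neg, mul_div_assoc', div_sub' hx, div_mul_eq_mul_div]
  congr 1
  have := Real.exp_ne_zero x
  field_simp
  ring

lemma speedSq_pos (hα : 0 < α) (hαβ : α < β) (hx : Real.log (β / α) < x) :
    0 < speedSq α β x :=
  div_pos (exp_sub_one_sub_pos ((log_div_pos hα hαβ).trans hx).ne')
    ((mul_exp_sub_pos_iff hα (hα.trans hαβ)).2 hx)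

lemma hasDerivAt_speedSq (hx : α * Real.exp x - β ≠ 0) :
    HasDerivAt (speedSq α β)
      (-(Real.exp x * endpointGap α β x) / (α * Real.exp x - β) ^ 2) x := by
  have hdiv := (((Real.hasDerivAt_exp x).sub_const 1).fun_sub (hasDerivAt_id x)).fun_div
    (((Real.hasDerivAt_exp x).const_mul α).sub_const β) hx
  refine hdiv.congr_deriv ?_
  congr 1
  have := Real.exp_ne_zero x
  simp only [endpointGap, id, Real.exp_neg]
  field_simp
  ring

lemma continuousOn_speedSq (hα : 0 < α) (hβ : 0 < β) :
    ContinuousOn (speedSq α β) (Ioi (Real.log (β / α))) := fun _ hx =>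
  (hasDerivAt_speedSq ((mul_exp_sub_pos_iff hα hβ).2 hx).ne').continuousAt.continuousWithinAt

lemma strictAntiOn_speedSq (hα : 0 < α) (hαβ : α < β) (hy : endpointGap α β y = 0) :
    StrictAntiOn (speedSq α β) (Ioc (Real.log (β / α)) y) := by
  have hβ := hα.trans hαβ
  refine strictAntiOn_of_deriv_neg (convex_Ioc _ _)
    ((continuousOn_speedSq hα hβ).mono Ioc_subset_Ioi_self) fun x hx => ?_
  rw [interior_Ioc] at hx
  have hden := (mul_exp_sub_pos_iff hα hβ).2 hx.1
  have hgap := endpointGap_pos_of_lt hβ ((log_div_pos hα hαβ).trans hx.1) hx.2 hy.ge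
  rw [(hasDerivAt_speedSq hden.ne').deriv, neg_div, neg_lt_zero]
  positivity

lemma tendsto_speedSq (hα : 0 < α) (hαβ : α < β) :
    Tendsto (speedSq α β) (𝓝[>] Real.log (β / α)) atTop := by
  have hβ := hα.trans hαβ
  have hnum : Tendsto (fun x => Real.exp x - 1 - x) (𝓝[>] Real.log (β / α))
      (𝓝 (Real.exp (Real.log (β / α)) - 1 - Real.log (β / α))) :=
    ((by fun_prop : Continuous fun x : ℝ => Real.exp x - 1 - x).tendsto _).mono_left
      nhdsWithin_le_nhds
  have hden : Tendsto (fun x => α * Real.exp x - β) (𝓝[>] Real.log (β / α)) (𝓝[>] 0) := by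
    refine tendsto_nhdsWithin_iff.2 ⟨?_, ?_⟩
    · have hlim := (by fun_prop : Continuous fun x : ℝ => α * Real.exp x - β).tendsto
        (Real.log (β / α))
      rw [Real.exp_log (by positivity), mul_div_cancel₀ _ hα.ne', sub_self] at hlim
      exact hlim.mono_left nhdsWithin_le_nhds
    · filter_upwards [self_mem_nhdsWithin] with x hx
      exact (mul_exp_sub_pos_iff hα hβ).2 hx
  exact hnum.pos_mul_atTop (exp_sub_one_sub_pos (log_div_pos hα hαβ).ne')
    (tendsto_inv_nhdsGT_zero.comp hden)

lemma levelSpeed_pos (hq : 0 < q) (hα : 0 < α) (hαβ : α < β) (hx : Real.log (β / α) < x) :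
    0 < levelSpeed q α β x :=
  Real.sqrt_pos.2 (mul_pos hq (speedSq_pos hα hαβ hx))

lemma levelSpeed_sq (hq : 0 < q) (hα : 0 < α) (hαβ : α < β) (hx : Real.log (β / α) < x) :
    levelSpeed q α β x ^ 2 = q * speedSq α β x :=
  Real.sq_sqrt (mul_pos hq (speedSq_pos hα hαβ hx)).le

lemma levelRadius_pos (hq : 0 < q) (hα : 0 < α) (hαβ : α < β) (hx : Real.log (β / α) < x) :
    0 < levelRadius q α β x :=
  div_pos ((log_div_pos hα hαβ).trans hx) (levelSpeed_pos hq hα hαβ hx)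

lemma levelSpeed_mul_levelRadius (hq : 0 < q) (hα : 0 < α) (hαβ : α < β)
    (hx : Real.log (β / α) < x) : levelSpeed q α β x * levelRadius q α β x = x :=
  mul_div_cancel₀ _ (levelSpeed_pos hq hα hαβ hx).ne'

lemma continuousOn_levelSpeed (hα : 0 < α) (hβ : 0 < β) :
    ContinuousOn (levelSpeed q α β) (Ioi (Real.log (β / α))) :=
  ((continuousOn_speedSq hα hβ).const_mul q).sqrt

lemma strictAntiOn_levelSpeed (hq : 0 < q) (hα : 0 < α) (hαβ : α < β)
    (hy : endpointGap α β y = 0) :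
    StrictAntiOn (levelSpeed q α β) (Ioc (Real.log (β / α)) y) := fun _ ha _ hb hab =>
  Real.sqrt_lt_sqrt (mul_pos hq (speedSq_pos hα hαβ hb.1)).le
    (mul_lt_mul_of_pos_left (strictAntiOn_speedSq hα hαβ hy ha hb hab) hq)

lemma tendsto_levelSpeed (hq : 0 < q) (hα : 0 < α) (hαβ : α < β) :
    Tendsto (levelSpeed q α β) (𝓝[>] Real.log (β / α)) atTop :=
  Real.tendsto_sqrt_atTop.comp ((tendsto_speedSq hα hαβ).const_mul_atTop hq)

lemma continuousOn_levelRadius (hq : 0 < q) (hα : 0 < α) (hαβ : α < β) :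
    ContinuousOn (levelRadius q α β) (Ioi (Real.log (β / α))) :=
  continuousOn_id.div (continuousOn_levelSpeed hα (hα.trans hαβ)) fun _ hx =>
    (levelSpeed_pos hq hα hαβ hx).ne'

lemma strictMonoOn_levelRadius (hq : 0 < q) (hα : 0 < α) (hαβ : α < β)
    (hy : endpointGap α β y = 0) :
    StrictMonoOn (levelRadius q α β) (Ioc (Real.log (β / α)) y) := fun _ ha _ hb hab =>
  div_lt_div₀ hab (strictAntiOn_levelSpeed hq hα hαβ hy ha hb hab).le
    ((log_div_pos hα hαβ).trans hb.1).le (levelSpeed_pos hq hα hαβ hb.1)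

lemma tendsto_levelRadius (hq : 0 < q) (hα : 0 < α) (hαβ : α < β) :
    Tendsto (levelRadius q α β) (𝓝[>] Real.log (β / α)) (𝓝 0) :=
  (tendsto_nhdsWithin_of_tendsto_nhds tendsto_id).div_atTop (tendsto_levelSpeed hq hα hαβ)

lemma transG_eq_zero_iff (hq : 0 < q) (hα : 0 < α) (hβ : 0 < β) {R c : ℝ} (hR : 0 < R)
    (hc : 0 < c) :
    transG q α β R c = 0 ↔
      Real.log (β / α) < c * R ∧ c ^ 2 = q * speedSq α β (c * R) := by
  have hnum := mul_pos (exp_sub_one_sub_pos (mul_pos hc hR).ne') hq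
  have hsq (hden : 0 < α * Real.exp (c * R) - β) :
      c ^ 2 = q * speedSq α β (c * R) ↔ transG q α β R c = 0 := by
    rw [speedSq, mul_div_assoc', eq_div_iff hden.ne', transG, sub_eq_zero, mul_comm q, eq_comm]
  refine ⟨fun hG => ?_, fun ⟨hx, hcs⟩ => (hsq ((mul_exp_sub_pos_iff hα hβ).2 hx)).1 hcs⟩
  have hden : 0 < α * Real.exp (c * R) - β := by
    rw [transG, sub_eq_zero] at hG
    exact pos_of_mul_pos_right (hG ▸ hnum) (sq_nonneg c)
  exact ⟨(mul_exp_sub_pos_iff hα hβ).1 hden, (hsq hden).2 hG⟩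

lemma mem_Qplus_iff_mul_le (hq : 0 < q) (hα : 0 < α) (hαβ : α < β)
    (hy0 : Real.log (β / α) < y) (hy : endpointGap α β y = 0) {R c : ℝ} (hc : 0 < c)
    (hx : Real.log (β / α) < c * R) (hcs : c ^ 2 = q * speedSq α β (c * R)) :
    (R, c) ∈ Qplus q β ↔ c * R ≤ y := by
  have hβ := hα.trans hαβ
  have hl := log_div_pos hα hαβ
  have hden := (mul_exp_sub_pos_iff hα hβ).2 hx
  have hscale : c * (c * β - q * R) = q * (β * speedSq α β (c * R) - c * R) := by
    linear_combination β * hcs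
  have hR : 0 < R := pos_of_mul_pos_right (hl.trans hx) hc.le
  calc (R, c) ∈ Qplus q β ↔ q * R / β ≤ c := and_iff_right hR
    _ ↔ 0 ≤ c * (c * β - q * R) := by
        rw [div_le_iff₀ hβ, ← sub_nonneg, mul_nonneg_iff_of_pos_left hc]
    _ ↔ 0 ≤ endpointGap α β (c * R) := by
        rw [hscale, mul_speedSq_sub_self hden.ne', mul_nonneg_iff_of_pos_left hq,
          mul_nonneg_iff_of_pos_left (by positivity)]
    _ ↔ c * R ≤ y := endpointGap_nonneg_iff hβ (hl.trans hx) (hl.trans hy0) hy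

lemma mem_phiCurve_iff (hq : 0 < q) (hα : 0 < α) (hαβ : α < β)
    (hy0 : Real.log (β / α) < y) (hy : endpointGap α β y = 0) {R c : ℝ} :
    (R, c) ∈ phiCurve q α β ↔ 0 < R ∧ 0 < c ∧ c * R ∈ Ioc (Real.log (β / α)) y ∧
      c ^ 2 = q * speedSq α β (c * R) := by
  have hβ := hα.trans hαβ
  constructor
  · rintro ⟨⟨hR, hQ⟩, hG⟩
    have hc : 0 < c := (div_pos (mul_pos hq hR) hβ).trans_le hQ
    obtain ⟨hx, hcs⟩ := (transG_eq_zero_iff hq hα hβ hR hc).1 hG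
    exact ⟨hR, hc, ⟨hx, (mem_Qplus_iff_mul_le hq hα hαβ hy0 hy hc hx hcs).1 ⟨hR, hQ⟩⟩, hcs⟩
  · rintro ⟨hR, hc, hx, hcs⟩
    exact ⟨(mem_Qplus_iff_mul_le hq hα hαβ hy0 hy hc hx.1 hcs).2 hx.2,
      (transG_eq_zero_iff hq hα hβ hR hc).2 ⟨hx.1, hcs⟩⟩

theorem phiCurve_eq_image (hq : 0 < q) (hα : 0 < α) (hαβ : α < β)
    (hy0 : Real.log (β / α) < y) (hy : endpointGap α β y = 0) :
    phiCurve q α β =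
      (fun x => (levelRadius q α β x, levelSpeed q α β x)) '' Ioc (Real.log (β / α)) y := by
  ext ⟨R, c⟩
  rw [mem_phiCurve_iff hq hα hαβ hy0 hy]
  constructor
  · rintro ⟨-, hc, hx, hcs⟩
    have hspeed : levelSpeed q α β (c * R) = c := by
      rw [levelSpeed, ← hcs, Real.sqrt_sq hc.le]
    have hradius : levelRadius q α β (c * R) = R := by
      rw [levelRadius, hspeed, mul_div_cancel_left₀ _ hc.ne']
    exact ⟨c * R, hx, Prod.ext hradius hspeed⟩
  · rintro ⟨x, hx, heq⟩
    obtain ⟨rfl, rfl⟩ := Prod.mk.inj heq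
    rw [levelSpeed_mul_levelRadius hq hα hαβ hx.1]
    exact ⟨levelRadius_pos hq hα hαβ hx.1, levelSpeed_pos hq hα hαβ hx.1, hx,
      levelSpeed_sq hq hα hαβ hx.1⟩

lemma levelSpeed_eq_mul_levelRadius_div (hq : 0 < q) (hα : 0 < α) (hαβ : α < β)
    (hy0 : Real.log (β / α) < y) (hy : endpointGap α β y = 0) :
    levelSpeed q α β y = q * levelRadius q α β y / β := by
  have hβ := hα.trans hαβ
  have hspeedSq := mul_speedSq_sub_self ((mul_exp_sub_pos_iff hα hβ).2 hy0).ne'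
  rw [hy, mul_zero, sub_eq_zero] at hspeedSq
  have hpos := levelSpeed_pos hq hα hαβ hy0
  rw [levelRadius, mul_div_assoc', div_div, eq_div_iff (by positivity)]
  linear_combination β * levelSpeed_sq hq hα hαβ hy0 + q * hspeedSq

theorem exists_phi (hq : 0 < q) (hα : 0 < α) (hαβ : α < β) :
    ∃ (R₀ : ℝ) (φ : ℝ → ℝ), 0 < R₀ ∧ phiCurve q α β = (Ioc 0 R₀).graphOn φ ∧
      ContinuousOn φ (Ioc 0 R₀) ∧ StrictAntiOn φ (Ioc 0 R₀) ∧ φ R₀ = q * R₀ / β ∧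
      Tendsto φ (𝓝[>] 0) atTop := by
  obtain ⟨y, hy0, hy⟩ := exists_endpointGap_eq_zero hα hαβ
  obtain ⟨φ, hgraph, hcont, hanti, hend, hlim⟩ := exists_graphOn_eq_image_prodMk hy0
    ((continuousOn_levelRadius hq hα hαβ).mono Ioc_subset_Ioi_self)
    (strictMonoOn_levelRadius hq hα hαβ hy) (tendsto_levelRadius hq hα hαβ)
    ((continuousOn_levelSpeed hα (hα.trans hαβ)).mono Ioc_subset_Ioi_self)
    (strictAntiOn_levelSpeed hq hα hαβ hy) (tendsto_levelSpeed hq hα hαβ)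
  exact ⟨levelRadius q α β y, φ, levelRadius_pos hq hα hαβ hy0,
    (phiCurve_eq_image hq hα hαβ hy0 hy).trans hgraph, hcont, hanti,
    hend.trans (levelSpeed_eq_mul_levelRadius_div hq hα hαβ hy0 hy), hlim⟩

end LevelSet

section Psi

lemma exists_orderIso_mul_sub {θ : ℝ} (hθ : 0 < θ) {V : ℝ → ℝ} (hV : Continuous V)
    (hV_anti : Antitone V) : ∃ e : ℝ ≃o ℝ, ∀ c, e c = c * θ - V c := by
  have hmono : StrictMono fun c => c * θ - V c := fun c d hcd => by
    linarith [mul_lt_mul_of_pos_right hcd hθ, hV_anti hcd.le]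
  have hsurj : Function.Surjective fun c => c * θ - V c := by
    refine Continuous.surjective (by fun_prop) ?_ ?_
    · refine tendsto_atTop_mono' _ ?_
        (tendsto_atTop_add_const_right _ (-V 0) (tendsto_id.atTop_mul_const hθ))
      filter_upwards [eventually_ge_atTop 0] with c hc
      exact add_le_add_right (neg_le_neg (hV_anti hc)) _
    · refine tendsto_atBot_mono' _ ?_
        (tendsto_atBot_add_const_right _ (-V 0) (tendsto_id.atBot_mul_const hθ))
      filter_upwards [eventually_le_atBot 0] with c hc
      exact add_le_add_right (neg_le_neg (hV_anti hc)) _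
  exact ⟨hmono.orderIsoOfSurjective _ hsurj, fun _ => rfl⟩

variable {q h : ℝ}

lemma one_add_thetaPlus_pow (hq : 0 < q) (hh : 0 < h) :
    (1 + thetaPlus q h) ^ 4 = 1 + q / h := by
  rw [thetaPlus, add_sub_cancel, ← Real.rpow_natCast, ← Real.rpow_mul (by positivity)]
  norm_num

lemma nonlinF_thetaPlus_sub (hq : 0 < q) (hh : 0 < h) (s : ℝ) :
    nonlinF q h (thetaPlus q h - s) = s * (h * (2 * (1 + thetaPlus q h) - s) *
      ((1 + thetaPlus q h) ^ 2 + (1 + thetaPlus q h - s) ^ 2)) := by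
  have hroot : q = h * ((1 + thetaPlus q h) ^ 4 - 1) := by
    rw [one_add_thetaPlus_pow hq hh, add_sub_cancel_left, mul_div_cancel₀ _ hh.ne']
  rw [nonlinF]
  linear_combination hroot

lemma antitoneOn_nonlinF (hh : 0 ≤ h) : AntitoneOn (nonlinF q h) (Ici (-1)) := by
  intro a ha b _ hab
  have : 0 ≤ 1 + a := neg_le_iff_add_nonneg'.1 ha
  unfold nonlinF
  gcongr

lemma exists_antitone_mem_stableSeparatrix_nonlinF {θhl : ℝ} (hq : 0 < q) (hh : 0 < h)
    (hθ : -1 ≤ θhl) (hθp : θhl < thetaPlus q h) :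
    ∃ V : ℝ → ℝ, (∀ c, 0 < V c) ∧ Antitone V ∧ Continuous V ∧
      ∀ c, (θhl, V c) ∈ stableSeparatrix (nonlinF q h) c θhl (thetaPlus q h) := by
  let m (s : ℝ) : ℝ :=
    h * (2 * (1 + thetaPlus q h) - s) * ((1 + thetaPlus q h) ^ 2 + (1 + thetaPlus q h - s) ^ 2)
  have hm_pos (s : ℝ) (hs : s ∈ Icc 0 (thetaPlus q h - θhl)) : 0 < m s := by
    have hfactor : 0 < 2 * (1 + thetaPlus q h) - s := by linarith [hs.2]
    have hbase : 0 < 1 + thetaPlus q h := by linarith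
    positivity
  obtain ⟨V, hpos, hanti, hlip, hmem⟩ := exists_antitone_mem_stableSeparatrix
    (sub_pos.2 hθp) (by fun_prop) hm_pos fun s _ => nonlinF_thetaPlus_sub hq hh s
  rw [sub_sub_cancel] at hmem
  exact ⟨V, hpos, hanti, hlip.continuous, hmem⟩

lemma mem_psiCurve_iff {θhl : ℝ} (hq : 0 < q) (hh : 0 < h) (hθ : 0 < θhl) {V : ℝ → ℝ}
    (hpos : ∀ c, 0 < V c)
    (hmem : ∀ c, (θhl, V c) ∈ stableSeparatrix (nonlinF q h) c θhl (thetaPlus q h)) {R c : ℝ} :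
    (R, c) ∈ psiCurve q h θhl ↔ 0 ≤ R ∧ c * θhl - V c = q * R := by
  have hF : AntitoneOn (nonlinF q h) (Icc θhl (thetaPlus q h)) :=
    (antitoneOn_nonlinF hh.le).mono fun x hx => by
      rw [mem_Ici]
      linarith [hx.1]
  constructor
  · rintro ⟨hR, hc, hS⟩
    have hVc : c * θhl - q * R = V c := stableSeparatrix_unique hc hF hS (hmem c)
    exact ⟨hR, by linarith⟩
  · rintro ⟨hR, hVc⟩
    have hqR : 0 ≤ q * R := mul_nonneg hq.le hR
    have hc : 0 < c := pos_of_mul_pos_left (by linarith [hpos c]) hθ.le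
    refine ⟨hR, hc, ?_⟩
    convert hmem c using 2
    linarith

theorem exists_psi {θhl : ℝ} (hq : 0 < q) (hh : 0 < h) (hθ : 0 < θhl)
    (hθp : θhl < thetaPlus q h) :
    ∃ ψ : ℝ → ℝ, psiCurve q h θhl = (Ici 0).graphOn ψ ∧ ContinuousOn ψ (Ici 0) ∧
      StrictMonoOn ψ (Ici 0) ∧ ∀ R, 0 ≤ R → q * R / θhl < ψ R := by
  obtain ⟨V, hpos, hanti, hcont, hmem⟩ :=
    exists_antitone_mem_stableSeparatrix_nonlinF hq hh (by linarith) hθp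
  obtain ⟨e, he⟩ := exists_orderIso_mul_sub hθ hcont hanti
  refine ⟨fun R => e.symm (q * R), ?_,
    (e.symm.continuous.comp (continuous_const_mul q)).continuousOn,
    (e.symm.strictMono.comp (strictMono_mul_left_of_pos hq)).strictMonoOn _, fun R _ => ?_⟩
  · ext ⟨R, c⟩
    rw [mem_psiCurve_iff hq hh hθ hpos hmem, mem_graphOn, ← he, e.symm_apply_eq, eq_comm,
      mem_Ici]
  · have heq := he (e.symm (q * R))
    rw [e.apply_symm_apply] at heq
    rw [div_lt_iff₀ hθ]
    linarith [hpos (e.symm (q * R))]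

end Psi

lemma mem_interior_Qplus {q θ R c : ℝ} (hR : 0 < R) (hc : q * R / θ < c) :
    (R, c) ∈ interior (Qplus q θ) := by
  have hopen : IsOpen {p : ℝ × ℝ | 0 < p.1 ∧ q * p.1 / θ < p.2} :=
    (isOpen_lt continuous_const continuous_fst).and
      (isOpen_lt (by fun_prop) continuous_snd)
  have hsub : {p : ℝ × ℝ | 0 < p.1 ∧ q * p.1 / θ < p.2} ⊆ Qplus q θ := fun p hp =>
    ⟨hp.1, hp.2.le⟩
  exact interior_maximal hsub hopen ⟨hR, hc⟩

theorem corollary5p1 (q h θig θhl : ℝ) (hq : 0 < q) (hh : 0 < h) (hig : 0 < θig)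
    (hig_hl : θig < θhl) (hhl : θhl < thetaPlus q h) :
    ∃ (R₀ : ℝ) (φ ψ : ℝ → ℝ),
      -- the curve `φ` on `(0, R₀]`
      0 < R₀ ∧
      phiCurve q θig θhl = (Ioc 0 R₀).graphOn φ ∧
      ContinuousOn φ (Ioc 0 R₀) ∧
      StrictAntiOn φ (Ioc 0 R₀) ∧
      φ R₀ = q * R₀ / θhl ∧
      Tendsto φ (𝓝[>] 0) atTop ∧
      -- the curve `ψ` on `[0, ∞)`
      psiCurve q h θhl = (Ici 0).graphOn ψ ∧
      ContinuousOn ψ (Ici 0) ∧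
      StrictMonoOn ψ (Ici 0) ∧
      (∀ R, 0 ≤ R → q * R / θhl < ψ R) ∧
      -- the two curves have exactly one common point, and it is interior to `Q₊`
      ∃ Rs cs : ℝ, (Rs, cs) ∈ interior (Qplus q θhl) ∧
        (Ioc 0 R₀).graphOn φ ∩ (Ici 0).graphOn ψ = {(Rs, cs)} := by
  obtain ⟨R₀, φ, hR₀, hφ, hφ_cont, hφ_anti, hφ_end, hφ_lim⟩ := exists_phi hq hig hig_hl
  obtain ⟨ψ, hψ, hψ_cont, hψ_mono, hψ_lt⟩ := exists_psi hq hh (hig.trans hig_hl) hhl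
  obtain ⟨R, hR, hinter⟩ := exists_graphOn_inter_graphOn_eq_singleton hR₀
    (fun _ hx => hx.1.le) hφ_cont hφ_anti hφ_lim hψ_cont hψ_mono.monotoneOn
    (hφ_end.trans_le (hψ_lt R₀ hR₀.le).le)
  exact ⟨R₀, φ, ψ, hR₀, hφ, hφ_cont, hφ_anti, hφ_end, hφ_lim, hψ, hψ_cont, hψ_mono, hψ_lt,
    R, ψ R, mem_interior_Qplus hR.1 (hψ_lt R hR.1.le), hinter⟩
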